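/- Let $G$ be a finite group, let $\ell$ be a prime dividing $|G|$, and suppose that $G$ is $\ell$-perfect, i.e. has no quotient isomorphic to $\mathbb Z/\ell$. Let $\mathbf C=(C_1,\dots,C_r)$ be conjugacy classes of $G$ (repetitions allowed) whose elements have order prime to $\ell$. A continuous epimorphism $\psi:A\to G$ from a profinite group is an $\ell$-Frattini cover if $\ker\psi$ is pro-$\ell$ and no proper closed subgroup of $A$ maps onto $G$. Let ${}_\ell\tilde\psi:{}_\ell\tilde G\to G$ be the universal $\ell$-Frattini cover, that is, an $\ell$-Frattini cover through which every finite $\ell$-Frattini cover of $G$ factors, and let ${}_\ell\tilde G_{\rm ab}={}_\ell\tilde G/\overline{[\ker{}_\ell\tilde\psi,\ker{}_\ell\tilde\psi]}\to G$ be its abelianization. Put $\ker_0=\ker({}_\ell\tilde G_{\rm ab}\to G)$, let $\ker_{k+1}$ be the closed subgroup generated by the $\ell$-th powers and the commutators of elements of $\ker_k$, and let $G_k={}_\ell\tilde G_{\rm ab}/\ker_k$ for $k\ge 0$ (so $G_0=G$). The Nielsen class $\mathrm{Ni}(G_k,\mathbf C)$ is the set of $\mathbf g=(g_1,\dots,g_r)\in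 G_k^r$ such that $\langle g_1,\dots,g_r\rangle=G_k$, $g_1g_2\cdots g_r=1$, and, for some permutation $\sigma$ of $\{1,\dots,r\}$, each $g_i$ maps into $C_{\sigma(i)}$ under $G_k\to G$ and has the same order as its image in $G$. Let $\mathrm{Ni}(G_k,\mathbf C)^{\rm in}$ be its quotient by simultaneous conjugation by $G_k$. The Hurwitz monodromy group $H_r$ acts on $\mathrm{Ni}(G_k,\mathbf C)^{\rm in}$ through $$q_i:(g_1,\dots,g_r)\mapsto(g_1,\dots,g_{i-1},\,g_ig_{i+1}g_i^{-1},\,g_i,\,g_{i+2},\dots,g_r)\quad(1\le i\le r-1),\qquad \mathbf{sh}:(g_1,\dots,g_r)\mapsto(g_2,\dots,g_r,g_1);$$ its orbits are called braid orbits. The level $k$ Hurwitz space $\mathcal H(G_k,\mathbf C)^{\rm in}$ is the covering, defined by this action, of the space of $r$-element subsets of $\mathbb P^1(\mathbb C)$; its fibre is $\mathrm{Ni}(G_k,\mathbf C)^{\rm in}$, so it is nonempty exactly when $\mathrm{Ni}(G_k,\mathbf C)^{\rm in}$ is, and its components correspond to the braid orbits. A Modular Tower is a sequence $(O_k)_{k\ge0}$,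 with $O_k$ a braid orbit on $\mathrm{Ni}(G_k,\mathbf C)^{\rm in}$, such that for every $k\ge 0$ the map induced by $G_{k+1}\to G_k$ maps $O_{k+1}$ onto $O_k$. **Lemma.** If $\mathrm{Ni}(G_k,\mathbf C)^{\rm in}$ is nonempty for every $k\ge0$ (every level of the Hurwitz space tower of ${}_\ell\tilde G_{\rm ab}$ is nonempty), then there is at least one Modular Tower $(O_k)_{k\ge 0}$. -/

import Mathlib

namespace ModularTower

/-! ### Frattini covers of a finite group -/

section Frattini

variable {A G : Type*} [Group A] [TopologicalSpace A] [Group G] [TopologicalSpace G]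

/-- A continuous homomorphism `ψ : A → G` is an `ℓ`-Frattini cover if it is onto, no proper closed
subgroup of `A` maps onto `G`, and its kernel is pro-`ℓ` (its image in `A / U` is an `ℓ`-group for
each open normal subgroup `U`). For finite discrete `A` the words "closed" and "pro" are void. -/
structure IsLFrattiniCover (ℓ : ℕ) (ψ : A →ₜ* G) : Prop where
  surjective : Function.Surjective ψ
  frattini : ∀ S : Subgroup A, IsClosed (S : Set A) → S.map ψ.toMonoidHom = ⊤ → S = ⊤
  proL : ∀ U : OpenNormalSubgroup A,
    IsPGroup ℓ (ψ.toMonoidHom.ker.map (QuotientGroup.mk' U.toSubgroup))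

/-- A universal `ℓ`-Frattini cover of `G`: an `ℓ`-Frattini cover `ψ : A → G` through which every
finite `ℓ`-Frattini cover of `G` factors (hence, by compactness, every profinite one). It is used
for profinite groups `A` and finite discrete groups `G`. -/
structure IsUniversalLFrattiniCover (ℓ : ℕ) (ψ : A →ₜ* G) : Prop
    extends IsLFrattiniCover ℓ ψ where
  universal : ∀ (H : Type) [Group H] [Finite H] [TopologicalSpace H] [DiscreteTopology H]
    (φ : H →ₜ* G), IsLFrattiniCover ℓ φ → ∃ f : A →ₜ* H, φ.comp f = ψ

/-- `G` is `ℓ`-perfect: it has no quotient `ℤ/ℓ`. -/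
def IsLPerfect (ℓ : ℕ) (G : Type*) [Group G] : Prop :=
  ¬ ∃ f : G →* Multiplicative (ZMod ℓ), Function.Surjective f

end Frattini

/-! ### Existence of the universal `ℓ`-Frattini cover -/

section Existence

universe u

theorem exists_minimal_closed {P G : Type*} [Group P] [TopologicalSpace P] [CompactSpace P]
    [Group G] [TopologicalSpace G] [T1Space G] (p : P →* G) (hp : Continuous p) (E : Subgroup P)
    (hE : IsClosed (E : Set P)) (hEp : E.map p = ⊤) :
    ∃ D ≤ E, IsClosed (D : Set P) ∧ D.map p = ⊤ ∧
      ∀ D' ≤ D, IsClosed (D' : Set P) → D'.map p = ⊤ → D' = D := by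
  let T := {D : Subgroup P // D ≤ E ∧ IsClosed (D : Set P) ∧ D.map p = ⊤}
  have : Nonempty T := ⟨⟨E, le_rfl, hE, hEp⟩⟩
  obtain ⟨D, hD⟩ := exists_maximal_of_nonempty_chains_bounded (α := T)
    (r := fun a b => b.1 ≤ a.1) (fun c hchain hcne => by
      have : Nonempty c := hcne.to_subtype
      obtain ⟨y, hy⟩ := hcne
      refine ⟨⟨⨅ s : c, s.1.1, (iInf_le _ (⟨y, hy⟩ : c)).trans y.2.1, ?_, ?_⟩,
        fun z hz => iInf_le (fun s : c => s.1.1) ⟨z, hz⟩⟩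
      · rw [Subgroup.coe_iInf]
        exact isClosed_iInter fun s => s.1.2.2.1
      · rw [eq_top_iff]
        intro x _
        have hne : (⋂ s : c, (s.1.1 : Set P) ∩ p ⁻¹' {x}).Nonempty := by
          have hcl : ∀ s : c, IsClosed ((s.1.1 : Set P) ∩ p ⁻¹' {x}) := fun s =>
            s.1.2.2.1.inter (isClosed_singleton.preimage hp)
          refine IsCompact.nonempty_iInter_of_directed_nonempty_isCompact_isClosed _ ?_ ?_
            (fun s => (hcl s).isCompact) hcl
          · intro s t
            by_cases hst : s = t
            · exact ⟨s, subset_rfl, by rw [hst]⟩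
            rcases hchain s.2 t.2 (fun h => hst (Subtype.ext h)) with h | h
            · exact ⟨t, Set.inter_subset_inter_left _ h, subset_rfl⟩
            · exact ⟨s, subset_rfl, Set.inter_subset_inter_left _ h⟩
          · intro s
            have : x ∈ s.1.1.map p := s.1.2.2.2.ge (Subgroup.mem_top x)
            obtain ⟨a, ha, hax⟩ := this
            exact ⟨a, ha, hax⟩
        obtain ⟨a, ha⟩ := hne
        rw [Set.mem_iInter] at ha
        refine ⟨a, ?_, (ha ⟨y, hy⟩).2⟩
        rw [Subgroup.coe_iInf]
        exact Set.mem_iInter.2 fun s => (ha s).1) (fun h1 h2 => h2.trans h1)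
  exact ⟨D.1, D.2.1, D.2.2.1, D.2.2.2, fun D' hle h1 h2 =>
    le_antisymm hle (hD ⟨D', hle.trans D.2.1, h1, h2⟩ hle)⟩

/-- Every finite group has a universal `ℓ`-Frattini cover: a minimal closed subgroup that maps onto
`G` in the completion of the free group on `G` with respect to the normal subgroups of finite index
that have `ℓ`-power index in the kernel of the map onto `G`. -/
theorem exists_isUniversalLFrattiniCover (G : Type u) [Group G] [Finite G] [TopologicalSpace G]
    [DiscreteTopology G] (ℓ : ℕ) :
    ∃ (A : Type u) (_ : Group A) (_ : TopologicalSpace A) (_ : IsTopologicalGroup A)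
      (_ : CompactSpace A) (_ : T2Space A) (_ : TotallyDisconnectedSpace A) (ψ : A →ₜ* G),
      IsUniversalLFrattiniCover ℓ ψ := by
  let π : FreeGroup G →* G := FreeGroup.lift id
  have hπ : Function.Surjective π := fun x => ⟨FreeGroup.of x, by simp [π]⟩
  let I : Type u := {N : Subgroup (FreeGroup G) // N.Normal ∧ Finite (FreeGroup G ⧸ N) ∧
    N ≤ π.ker ∧ ∀ x ∈ π.ker, ∃ n : ℕ, x ^ ℓ ^ n ∈ N}
  have hnorm : ∀ i : I, i.1.Normal := fun i => i.2.1
  have hfin : ∀ i : I, Finite (FreeGroup G ⧸ i.1) := fun i => i.2.2.1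
  let _ : ∀ i : I, TopologicalSpace (FreeGroup G ⧸ i.1) := fun _ => ⊥
  have : ∀ i : I, DiscreteTopology (FreeGroup G ⧸ i.1) := fun _ => ⟨rfl⟩
  let i₀ : I := ⟨π.ker, inferInstance,
    Finite.of_injective _ (QuotientGroup.kerLift_injective π), le_rfl,
    fun x hx => ⟨0, by simpa using hx⟩⟩
  let P : Type u := ∀ i : I, FreeGroup G ⧸ i.1
  let ι : FreeGroup G →* P := MonoidHom.pi fun i => QuotientGroup.mk' i.1
  let p : P →* G := (QuotientGroup.kerLift π).comp (Pi.evalMonoidHom _ i₀)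
  have hp : Continuous p :=
    (continuous_of_discreteTopology (α := FreeGroup G ⧸ i₀.1)
      (f := QuotientGroup.kerLift π)).comp (continuous_apply i₀)
  have hpι : ∀ x, p (ι x) = π x := fun x => rfl
  let E : Subgroup P := ι.range.topologicalClosure
  have hE : IsClosed (E : Set P) := Subgroup.isClosed_topologicalClosure _
  have hEp : E.map p = ⊤ := by
    rw [eq_top_iff]
    intro x _
    obtain ⟨f, rfl⟩ := hπ x
    exact ⟨ι f, Subgroup.le_topologicalClosure _ ⟨f, rfl⟩, hpι f⟩
  -- elements of `E` agree with words at any two coordinates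
  have happrox : ∀ x ∈ E, ∀ i j : I, ∃ f : FreeGroup G, x i = ι f i ∧ x j = ι f j := by
    intro x hx i j
    have hx' : x ∈ closure (ι.range : Set P) := hx
    rw [mem_closure_iff] at hx'
    have hopen : ∀ i : I, IsOpen {y : P | y i = x i} := fun i =>
      (isOpen_discrete ({x i} : Set (FreeGroup G ⧸ i.1))).preimage
        (continuous_apply (A := fun i : I => FreeGroup G ⧸ i.1) i)
    obtain ⟨y, ⟨hy1, hy2⟩, f, rfl⟩ := hx' _ ((hopen i).inter (hopen j)) ⟨rfl, rfl⟩
    exact ⟨f, hy1.symm, hy2.symm⟩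
  obtain ⟨D, hDE, hDcl, hDp, hDmin⟩ := exists_minimal_closed p hp E hE hEp
  have : CompactSpace D := isCompact_iff_compactSpace.1 hDcl.isCompact
  let ψ : D →ₜ* G := ⟨p.comp D.subtype, hp.comp continuous_subtype_val⟩
  have htors : ∀ x ∈ E, p x = 1 → ∀ i : I, ∃ n : ℕ, x i ^ ℓ ^ n = 1 := by
    intro x hx hpx i
    obtain ⟨f, hf, hf0⟩ := happrox x hx i i₀
    have hfk : f ∈ π.ker := by
      rw [MonoidHom.mem_ker, ← hpι f, ← hpx]
      exact congrArg (QuotientGroup.kerLift π) hf0.symm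
    obtain ⟨n, hn⟩ := i.2.2.2.2 f hfk
    refine ⟨n, ?_⟩
    rw [hf]
    exact (QuotientGroup.eq_one_iff (N := i.1) _).2 hn
  refine ⟨D, inferInstance, inferInstance, inferInstance, inferInstance, inferInstance,
    inferInstance, ψ, ⟨⟨?_, ?_, ?_⟩, ?_⟩⟩
  · intro x
    have : x ∈ D.map p := hDp ▸ Subgroup.mem_top x
    obtain ⟨d, hd, rfl⟩ := this
    exact ⟨⟨d, hd⟩, rfl⟩
  · intro S hS hSt
    have h1 : IsClosed ((S.map D.subtype : Subgroup P) : Set P) := by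
      rw [Subgroup.coe_map]
      exact hDcl.isClosedEmbedding_subtypeVal.isClosedMap _ hS
    have h2 : (S.map D.subtype).map p = ⊤ := by
      rw [Subgroup.map_map]; exact hSt
    have h3 := hDmin _ (Subgroup.map_subtype_le S) h1 h2
    rw [eq_top_iff]
    intro x _
    have : (x : P) ∈ S.map D.subtype := h3.ge x.2
    obtain ⟨y, hy, hyx⟩ := this
    rwa [← Subtype.ext hyx]
  · rintro U ⟨_, x, hx, rfl⟩
    have hUo : IsOpen ((U.toSubgroup : Subgroup D) : Set D) := U.isOpen'
    obtain ⟨V, hVo, hVU⟩ := isOpen_induced_iff.1 hUo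
    have h1V : (1 : P) ∈ V := by
      have : (1 : D) ∈ (Subtype.val ⁻¹' V : Set D) := hVU ▸ U.toSubgroup.one_mem
      exact this
    obtain ⟨J, u, hu, huV⟩ := isOpen_pi_iff.1 hVo 1 h1V
    choose n hn using htors x.1 (hDE x.2) hx
    refine ⟨∑ j ∈ J, n j, ?_⟩
    have hmem : x ^ ℓ ^ (∑ j ∈ J, n j) ∈ (Subtype.val ⁻¹' V : Set D) := by
      refine huV fun j hj => ?_
      have : (x.1 ^ ℓ ^ (∑ j ∈ J, n j)) j = 1 := by
        obtain ⟨m, hm⟩ := Nat.exists_eq_add_of_le (Finset.single_le_sum (f := n)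
          (fun _ _ => Nat.zero_le _) hj)
        rw [hm, pow_add, Pi.pow_apply, pow_mul, hn j, one_pow]
      change (x.1 ^ ℓ ^ (∑ j ∈ J, n j)) j ∈ u j
      rw [this]
      exact (hu j hj).2
    rw [hVU] at hmem
    apply Subtype.ext
    exact (QuotientGroup.eq_one_iff (N := U.toSubgroup) _).2 hmem
  · intro H _ _ _ _ φ hφ
    choose s hs using hφ.surjective
    let f₀ : FreeGroup G →* H := FreeGroup.lift s
    have hf₀ : ∀ x, φ (f₀ x) = π x := by
      have : φ.toMonoidHom.comp f₀ = π := by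
        ext g
        simp [f₀, π, hs]
      exact fun x => DFunLike.congr_fun this x
    let i : I := ⟨f₀.ker, inferInstance,
      Finite.of_injective _ (QuotientGroup.kerLift_injective f₀), fun x hx => by
        rw [MonoidHom.mem_ker] at hx ⊢
        rw [← hf₀, hx, map_one], fun x hx => by
        have hx' : f₀ x ∈ φ.toMonoidHom.ker := by
          rw [MonoidHom.mem_ker] at hx ⊢
          exact (hf₀ x).trans hx
        let U : OpenNormalSubgroup H :=
          { toSubgroup := ⊥, isOpen' := isOpen_discrete _, isNormal' := inferInstance }
        obtain ⟨n, hn⟩ := hφ.proL U ⟨_, f₀ x, hx', rfl⟩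
        refine ⟨n, ?_⟩
        have h2 := congrArg Subtype.val hn
        have h3 : f₀ x ^ ℓ ^ n ∈ (⊥ : Subgroup H) :=
          (QuotientGroup.eq_one_iff (N := U.toSubgroup) _).1 h2
        rw [MonoidHom.mem_ker, map_pow]
        exact Subgroup.mem_bot.1 h3⟩
    let f : P →* H := (QuotientGroup.kerLift f₀).comp (Pi.evalMonoidHom _ i)
    have hf : Continuous f :=
      (continuous_of_discreteTopology (α := FreeGroup G ⧸ i.1)
        (f := QuotientGroup.kerLift f₀)).comp (continuous_apply i)
    refine ⟨⟨f.comp D.subtype, hf.comp continuous_subtype_val⟩, ?_⟩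
    ext x
    obtain ⟨w, hw, hw0⟩ := happrox x.1 (hDE x.2) i i₀
    have e1 : f x.1 = f₀ w := congrArg (QuotientGroup.kerLift f₀) hw
    have e2 : p x.1 = π w := congrArg (QuotientGroup.kerLift π) hw0
    change φ (f x.1) = p x.1
    rw [e1, e2, hf₀]

end Existence

/-! ### The abelianized cover, characteristic kernels and levels -/

section Levels

variable {A G : Type*} [Group A] [TopologicalSpace A] [IsTopologicalGroup A]
  [Group G] [TopologicalSpace G]

/-- The closed commutator subgroup of the kernel of `ψ`. -/
def kerCommutator (ψ : A →ₜ* G) : Subgroup A :=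
  ⁅ψ.toMonoidHom.ker, ψ.toMonoidHom.ker⁆.topologicalClosure

instance (ψ : A →ₜ* G) : (kerCommutator ψ).Normal :=
  Subgroup.is_normal_topologicalClosure _

theorem isClosed_ker {A G : Type*} [Group A] [TopologicalSpace A] [Group G] [TopologicalSpace G]
    [T1Space G] (ψ : A →ₜ* G) : IsClosed (ψ.toMonoidHom.ker : Set A) :=
  (isClosed_singleton (x := (1 : G))).preimage ψ.continuous_toFun

theorem kerCommutator_le [T1Space G] (ψ : A →ₜ* G) : kerCommutator ψ ≤ ψ.toMonoidHom.ker :=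
  Subgroup.topologicalClosure_minimal _ (Subgroup.commutator_le_right _ _) (isClosed_ker ψ)

/-- The abelianization `A / [ker ψ, ker ψ]` of a cover `ψ : A → G`. -/
abbrev AbCover (ψ : A →ₜ* G) : Type _ := A ⧸ kerCommutator ψ

/-- The map `A / [ker ψ, ker ψ] → G` induced by `ψ`. -/
def abCoverMap [T1Space G] (ψ : A →ₜ* G) : AbCover ψ →ₜ* G where
  toMonoidHom := QuotientGroup.lift (kerCommutator ψ) ψ.toMonoidHom (kerCommutator_le ψ)
  continuous_toFun := Continuous.quotient_lift ψ.continuous_toFun _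

/-- The `ℓ`-Frattini subgroup of `K`: the closed subgroup generated by the `ℓ`-th powers and the
commutators of elements of `K`. -/
def lFrattini (ℓ : ℕ) (K : Subgroup A) : Subgroup A :=
  (Subgroup.closure ((fun x => x ^ ℓ) '' (K : Set A)) ⊔ ⁅K, K⁆).topologicalClosure

instance (ℓ : ℕ) (K : Subgroup A) [hK : K.Normal] : (lFrattini ℓ K).Normal := by
  have : (Subgroup.closure ((fun x => x ^ ℓ) '' (K : Set A))).Normal := by
    refine ⟨fun n hn a => ?_⟩
    induction hn using Subgroup.closure_induction with
    | mem x hx =>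
      obtain ⟨y, hy, rfl⟩ := hx
      exact Subgroup.subset_closure ⟨a * y * a⁻¹, hK.conj_mem y hy a, by simp [conj_pow]⟩
    | one => simp
    | mul x y _ _ hx hy => simpa [mul_assoc] using mul_mem hx hy
    | inv x _ hx => simpa [mul_assoc] using inv_mem hx
  exact Subgroup.is_normal_topologicalClosure _

/-- The characteristic kernels of `ψ`: `ker_0 = ker ψ` and `ker_{k+1}` is the `ℓ`-Frattini
subgroup of `ker_k`. -/
def charKer (ℓ : ℕ) (ψ : A →ₜ* G) : ℕ → Subgroup A
  | 0 => ψ.toMonoidHom.ker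
  | k + 1 => lFrattini ℓ (charKer ℓ ψ k)

instance charKer_normal (ℓ : ℕ) (ψ : A →ₜ* G) : (k : ℕ) → (charKer ℓ ψ k).Normal
  | 0 => inferInstanceAs ψ.toMonoidHom.ker.Normal
  | k + 1 => by
    have := charKer_normal ℓ ψ k
    exact inferInstanceAs (lFrattini ℓ (charKer ℓ ψ k)).Normal

theorem isClosed_charKer [T1Space G] (ℓ : ℕ) (ψ : A →ₜ* G) :
    (k : ℕ) → IsClosed (charKer ℓ ψ k : Set A)
  | 0 => isClosed_ker ψ
  | _ + 1 => Subgroup.isClosed_topologicalClosure _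

theorem charKer_succ_le [T1Space G] (ℓ : ℕ) (ψ : A →ₜ* G) (k : ℕ) :
    charKer ℓ ψ (k + 1) ≤ charKer ℓ ψ k := by
  refine Subgroup.topologicalClosure_minimal _ (sup_le ?_ ?_) (isClosed_charKer ℓ ψ k)
  · rw [Subgroup.closure_le]
    rintro _ ⟨x, hx, rfl⟩
    exact pow_mem hx ℓ
  · exact Subgroup.commutator_le_right _ _

theorem charKer_le_ker [T1Space G] (ℓ : ℕ) (ψ : A →ₜ* G) (k : ℕ) :
    charKer ℓ ψ k ≤ ψ.toMonoidHom.ker := by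
  induction k with
  | zero => exact le_rfl
  | succ k ih => exact (charKer_succ_le ℓ ψ k).trans ih

/-- The level `k` group `A / ker_k` of the cover `ψ : A → G`; level `0` is a copy of `G`. -/
abbrev Level (ℓ : ℕ) (ψ : A →ₜ* G) (k : ℕ) : Type _ := A ⧸ charKer ℓ ψ k

/-- The natural map from level `k` to `G`. -/
def levelToBase [T1Space G] (ℓ : ℕ) (ψ : A →ₜ* G) (k : ℕ) : Level ℓ ψ k →* G :=
  QuotientGroup.lift (charKer ℓ ψ k) ψ.toMonoidHom (charKer_le_ker ℓ ψ k)

/-- The natural map from level `k + 1` to level `k`. -/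
def levelMap [T1Space G] (ℓ : ℕ) (ψ : A →ₜ* G) (k : ℕ) : Level ℓ ψ (k + 1) →* Level ℓ ψ k :=
  QuotientGroup.map _ _ (MonoidHom.id A) (charKer_succ_le ℓ ψ k)

theorem levelMap_surjective [T1Space G] (ℓ : ℕ) (ψ : A →ₜ* G) (k : ℕ) :
    Function.Surjective (levelMap ℓ ψ k) := by
  intro y
  obtain ⟨a, rfl⟩ := QuotientGroup.mk_surjective y
  exact ⟨QuotientGroup.mk a, rfl⟩

theorem levelToBase_comp_levelMap [T1Space G] (ℓ : ℕ) (ψ : A →ₜ* G) (k : ℕ) :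
    (levelToBase ℓ ψ k).comp (levelMap ℓ ψ k) = levelToBase ℓ ψ (k + 1) := by
  ext x
  rfl

end Levels

/-! ### Nielsen classes and the braid action -/

section Nielsen

variable {H H' G : Type*} [Group H] [Group H'] [Group G] {r : ℕ}

/-- The tuples `g ∈ H^r` that lie in the Nielsen class `Ni(H, C)`. Here `φ : H → G` is a cover and
`C` are `r` conjugacy classes of `G`, counted with multiplicity. Each class `C_i` is lifted to the
elements of `H` that lie over `C_i` and have the same order as their image in `G`; if the elements
of `C_i` have order prime to `ℓ` and `ker φ` is a finite `ℓ`-group, these form one conjugacy class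
of `H`. The entries of `g` lie in the lifted classes in some order, generate `H`, and have
product one. -/
structure IsNielsen (φ : H →* G) (C : Fin r → ConjClasses G) (g : Fin r → H) : Prop where
  mem_classes : ∃ σ : Equiv.Perm (Fin r), ∀ i,
    ConjClasses.mk (φ (g i)) = C (σ i) ∧ orderOf (g i) = orderOf (φ (g i))
  generates : Subgroup.closure (Set.range g) = ⊤
  prod_one : (List.ofFn g).prod = 1

/-- The Nielsen class `Ni(H, C)`. -/
abbrev Nielsen (φ : H →* G) (C : Fin r → ConjClasses G) : Type _ :=
  {g : Fin r → H // IsNielsen φ C g}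

/-- The braid generator `q` at the positions `i`, `j = i + 1`:
`(…, g_i, g_j, …) ↦ (…, g_i g_j g_i⁻¹, g_i, …)`. -/
def braidFun (i j : Fin r) (g : Fin r → H) : Fin r → H := fun k =>
  if k = i then g i * g j * (g i)⁻¹ else if k = j then g i else g k

/-- The inverse braid generator: `(…, g_i, g_j, …) ↦ (…, g_j, g_j⁻¹ g_i g_j, …)`. -/
def braidInvFun (i j : Fin r) (g : Fin r → H) : Fin r → H := fun k =>
  if k = i then g j else if k = j then (g j)⁻¹ * g i * g j else g k

/-- The braid generator as a permutation of `H^r`. -/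
def braidPerm {i j : Fin r} (hij : i ≠ j) : Equiv.Perm (Fin r → H) where
  toFun := braidFun i j
  invFun := braidInvFun i j
  left_inv g := by
    funext k
    by_cases hi : k = i
    · subst hi; simp [braidFun, braidInvFun, hij.symm]
    · by_cases hj : k = j
      · subst hj; simp [braidFun, braidInvFun, hij.symm, mul_assoc]
      · simp [braidFun, braidInvFun, hi, hj]
  right_inv g := by
    funext k
    by_cases hi : k = i
    · subst hi; simp [braidFun, braidInvFun, hij.symm, mul_assoc]
    · by_cases hj : k = j
      · subst hj; simp [braidFun, braidInvFun, hij.symm]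
      · simp [braidFun, braidInvFun, hi, hj]

theorem prod_braidFun : ∀ {r : ℕ} (i : ℕ) (hi : i + 1 < r) (g : Fin r → H),
    (List.ofFn (braidFun ⟨i, by omega⟩ ⟨i + 1, hi⟩ g)).prod = (List.ofFn g).prod
  | 0, _, hi, _ => by omega
  | 1, _, hi, _ => by omega
  | r + 2, 0, _, g => by
    rw [List.ofFn_succ, List.ofFn_succ, List.ofFn_succ (f := g),
      List.ofFn_succ (f := fun k : Fin (r + 1) => g k.succ)]
    simp [braidFun, Fin.ext_iff, mul_assoc]
  | r + 2, i + 1, hi, g => by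
    have := prod_braidFun i (by omega) (fun k : Fin (r + 1) => g k.succ)
    rw [List.ofFn_succ, List.prod_cons, List.ofFn_succ (f := g), List.prod_cons, ← this]
    simp [braidFun, Fin.ext_iff]

theorem exists_perm_iff_of_conj {φ : H →* G} {C : Fin r → ConjClasses G} {g g' : Fin r → H}
    (τ : Equiv.Perm (Fin r)) (h : ∀ k, ∃ a, g' k = a * g (τ k) * a⁻¹) :
    (∃ σ : Equiv.Perm (Fin r), ∀ i,
        ConjClasses.mk (φ (g i)) = C (σ i) ∧ orderOf (g i) = orderOf (φ (g i))) ↔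
      ∃ σ : Equiv.Perm (Fin r), ∀ i,
        ConjClasses.mk (φ (g' i)) = C (σ i) ∧ orderOf (g' i) = orderOf (φ (g' i)) := by
  have key : ∀ k, ConjClasses.mk (φ (g' k)) = ConjClasses.mk (φ (g (τ k))) ∧
      orderOf (g' k) = orderOf (g (τ k)) ∧ orderOf (φ (g' k)) = orderOf (φ (g (τ k))) := by
    intro k
    obtain ⟨a, ha⟩ := h k
    refine ⟨?_, ?_, ?_⟩
    · rw [ConjClasses.mk_eq_mk_iff_isConj, ha]
      exact (isConj_iff.2 ⟨φ a, by simp⟩).symm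
    · rw [ha]
      exact orderOf_injective (MulAut.conj a).toMonoidHom (MulAut.conj a).injective _
    · rw [ha, map_mul, map_mul, map_inv]
      exact orderOf_injective (MulAut.conj (φ a)).toMonoidHom (MulAut.conj (φ a)).injective _
  constructor
  · rintro ⟨σ, hσ⟩
    refine ⟨τ.trans σ, fun k => ?_⟩
    rw [(key k).1, (key k).2.1, (key k).2.2]
    exact hσ (τ k)
  · rintro ⟨σ, hσ⟩
    refine ⟨τ.symm.trans σ, fun k => ?_⟩
    have h1 := key (τ.symm k)
    rw [Equiv.apply_symm_apply] at h1
    rw [← h1.1, ← h1.2.1, ← h1.2.2]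
    exact hσ (τ.symm k)

theorem isNielsen_braidPerm {φ : H →* G} {C : Fin r → ConjClasses G} (i : ℕ) (hi : i + 1 < r)
    (g : Fin r → H) :
    IsNielsen φ C g ↔
      IsNielsen φ C (braidPerm (i := ⟨i, by omega⟩) (j := ⟨i + 1, hi⟩) (by simp) g) := by
  set p : Fin r := ⟨i, by omega⟩ with hp
  set q : Fin r := ⟨i + 1, hi⟩ with hq
  have hpq : p ≠ q := by simp [hp, hq]
  set g' := braidPerm (H := H) hpq g with hg'
  have h1 : g' p = g p * g q * (g p)⁻¹ := by simp [hg', braidPerm, braidFun]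
  have h2 : g' q = g p := by simp [hg', braidPerm, braidFun, hpq.symm]
  have h3 : ∀ k, k ≠ p → k ≠ q → g' k = g k := fun k hk hk' => by
    simp [hg', braidPerm, braidFun, hk, hk']
  have hconj : ∀ k, ∃ a, g' k = a * g (Equiv.swap p q k) * a⁻¹ := by
    intro k
    by_cases hkp : k = p
    · exact ⟨g p, by rw [hkp, h1, Equiv.swap_apply_left]⟩
    · by_cases hkq : k = q
      · subst hkq; exact ⟨1, by rw [h2, Equiv.swap_apply_right]; simp⟩
      · exact ⟨1, by rw [h3 k hkp hkq, Equiv.swap_apply_of_ne_of_ne hkp hkq]; simp⟩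
  have hcl : Subgroup.closure (Set.range g') = Subgroup.closure (Set.range g) := by
    have hm : ∀ k, g k ∈ Subgroup.closure (Set.range g) := fun k =>
      Subgroup.subset_closure ⟨k, rfl⟩
    have hm' : ∀ k, g' k ∈ Subgroup.closure (Set.range g') := fun k =>
      Subgroup.subset_closure ⟨k, rfl⟩
    apply le_antisymm
    · rw [Subgroup.closure_le]
      rintro _ ⟨k, rfl⟩
      by_cases hkp : k = p
      · subst hkp; rw [h1]; exact mul_mem (mul_mem (hm _) (hm _)) (inv_mem (hm _))
      · by_cases hkq : k = q
        · subst hkq; rw [h2]; exact hm _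
        · rw [h3 k hkp hkq]; exact hm _
    · rw [Subgroup.closure_le]
      rintro _ ⟨k, rfl⟩
      by_cases hkp : k = p
      · subst hkp; rw [← h2]; exact hm' _
      · by_cases hkq : k = q
        · have : g k = (g' q)⁻¹ * g' p * g' q := by rw [hkq, h1, h2]; group
          rw [this]; exact mul_mem (mul_mem (inv_mem (hm' _)) (hm' _)) (hm' _)
        · rw [← h3 k hkp hkq]; exact hm' _
  have hprod : (List.ofFn g').prod = (List.ofFn g).prod := prod_braidFun i hi g
  constructor
  · rintro ⟨a, b, c⟩
    exact ⟨(exists_perm_iff_of_conj _ hconj).1 a, hcl.trans b, hprod.trans c⟩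
  · rintro ⟨a, b, c⟩
    exact ⟨(exists_perm_iff_of_conj _ hconj).2 a, hcl.symm.trans b, hprod.symm.trans c⟩

/-- The shift `(g_1, …, g_r) ↦ (g_2, …, g_r, g_1)` as a permutation of `H^r`. -/
def shiftPerm : Equiv.Perm (Fin r → H) where
  toFun g := g ∘ finRotate r
  invFun g := g ∘ (finRotate r).symm
  left_inv g := by
    funext k
    exact congrArg g ((finRotate r).apply_symm_apply k)
  right_inv g := by
    funext k
    exact congrArg g ((finRotate r).symm_apply_apply k)

theorem prod_shiftPerm (g : Fin r → H) :
    (List.ofFn (shiftPerm g)).prod = 1 ↔ (List.ofFn g).prod = 1 := by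
  cases r with
  | zero => simp
  | succ n =>
    have h : ∀ k : Fin n, finRotate (n + 1) k.castSucc = k.succ := fun k => by
      rw [finRotate_apply, Fin.coeSucc_eq_succ]
    rw [List.ofFn_succ', List.ofFn_succ (f := g), List.concat_eq_append, List.prod_append,
      List.prod_cons, mul_eq_one_comm]
    simp [shiftPerm, h]

theorem isNielsen_shiftPerm {φ : H →* G} {C : Fin r → ConjClasses G} (g : Fin r → H) :
    IsNielsen φ C g ↔ IsNielsen φ C (shiftPerm g) := by
  have hconj : ∀ k, ∃ a, shiftPerm g k = a * g (finRotate r k) * a⁻¹ := fun k =>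
    ⟨1, by simp [shiftPerm]⟩
  have hr : Set.range (shiftPerm g) = Set.range g := (finRotate r).surjective.range_comp g
  constructor
  · rintro ⟨a, b, c⟩
    exact ⟨(exists_perm_iff_of_conj _ hconj).1 a, by rw [hr, b], (prod_shiftPerm g).2 c⟩
  · rintro ⟨a, b, c⟩
    exact ⟨(exists_perm_iff_of_conj _ hconj).2 a, by rw [← hr, b], (prod_shiftPerm g).1 c⟩

/-- Inner equivalence: simultaneous conjugation by an element of `H`. -/
def innerSetoid (φ : H →* G) (C : Fin r → ConjClasses G) : Setoid (Nielsen φ C) where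
  r g g' := ∃ h : H, ∀ i, g'.1 i = h * g.1 i * h⁻¹
  iseqv :=
    { refl := fun _ => ⟨1, by simp⟩
      symm := by
        rintro g g' ⟨h, hh⟩
        exact ⟨h⁻¹, fun i => by rw [hh]; group⟩
      trans := by
        rintro g g' g'' ⟨h, hh⟩ ⟨k, hk⟩
        exact ⟨k * h, fun i => by rw [hk, hh]; group⟩ }

/-- The inner Nielsen class `Ni(H, C)^in = Ni(H, C) / H`. -/
def InnerNielsen (φ : H →* G) (C : Fin r → ConjClasses G) : Type _ :=
  Quotient (innerSetoid φ C)

/-- The braid generator `q_{i+1}` acting on the inner Nielsen class (`i` counts from `0`). -/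
def braidGen (φ : H →* G) (C : Fin r → ConjClasses G) (i : ℕ) (hi : i + 1 < r) :
    Equiv.Perm (InnerNielsen φ C) :=
  Quotient.congr ((braidPerm (i := ⟨i, by omega⟩) (j := ⟨i + 1, hi⟩) (by simp)).subtypeEquiv
    (isNielsen_braidPerm i hi)) (by
      rintro ⟨g, hg⟩ ⟨g', hg'⟩
      constructor
      · rintro ⟨h, hh⟩
        refine ⟨h, fun k => ?_⟩
        simp only [Equiv.subtypeEquiv_apply, braidPerm, Equiv.coe_fn_mk, braidFun] at hh ⊢
        simp only [hh]
        split_ifs <;> group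
      · rintro ⟨h, hh⟩
        refine ⟨h, fun k => ?_⟩
        have e : ∀ x : Fin r → H, x = braidInvFun ⟨i, by omega⟩ ⟨i + 1, hi⟩
            (braidFun ⟨i, by omega⟩ ⟨i + 1, hi⟩ x) := fun x =>
          ((braidPerm (H := H) (i := ⟨i, by omega⟩) (j := ⟨i + 1, hi⟩)
            (by simp)).symm_apply_apply x).symm
        change ∀ k, braidFun ⟨i, by omega⟩ ⟨i + 1, hi⟩ g' k =
          h * braidFun ⟨i, by omega⟩ ⟨i + 1, hi⟩ g k * h⁻¹ at hh
        change g' k = h * g k * h⁻¹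
        rw [e g', e g]
        generalize braidFun ⟨i, by omega⟩ ⟨i + 1, hi⟩ g' = y' at hh ⊢
        generalize braidFun ⟨i, by omega⟩ ⟨i + 1, hi⟩ g = y at hh ⊢
        simp only [braidInvFun, hh]
        split_ifs <;> group)

/-- The shift `sh` acting on the inner Nielsen class. -/
def shiftGen (φ : H →* G) (C : Fin r → ConjClasses G) : Equiv.Perm (InnerNielsen φ C) :=
  Quotient.congr (shiftPerm.subtypeEquiv isNielsen_shiftPerm) (by
    rintro ⟨g, hg⟩ ⟨g', hg'⟩
    constructor
    · rintro ⟨h, hh⟩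
      exact ⟨h, fun k => hh (finRotate r k)⟩
    · rintro ⟨h, hh⟩
      refine ⟨h, fun k => ?_⟩
      have hk := hh ((finRotate r).symm k)
      change g' (finRotate r ((finRotate r).symm k)) =
        h * g (finRotate r ((finRotate r).symm k)) * h⁻¹ at hk
      rwa [Equiv.apply_symm_apply] at hk)

/-- The group of permutations of `Ni(H, C)^in` through which the Hurwitz monodromy group `H_r`
acts: it is generated by `q_1, …, q_{r-1}` and `sh`. -/
def hurwitzGroup (φ : H →* G) (C : Fin r → ConjClasses G) :
    Subgroup (Equiv.Perm (InnerNielsen φ C)) :=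
  Subgroup.closure ({q | ∃ i, ∃ hi : i + 1 < r, q = braidGen φ C i hi} ∪ {shiftGen φ C})

/-- Braid orbits on `Ni(H, C)^in`; they correspond to the (absolutely irreducible) components of
the Hurwitz space `ℋ(H, C)^in`. -/
def IsBraidOrbit (φ : H →* G) (C : Fin r → ConjClasses G) (O : Set (InnerNielsen φ C)) : Prop :=
  ∃ x, O = MulAction.orbit (hurwitzGroup φ C) x

theorem IsNielsen.map {φ : H →* G} {φ' : H' →* G} {C : Fin r → ConjClasses G} {f : H' →* H}
    (hf : Function.Surjective f) (hφ : φ.comp f = φ') {g : Fin r → H'} (hg : IsNielsen φ' C g) :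
    IsNielsen φ C (f ∘ g) := by
  subst hφ
  obtain ⟨⟨σ, hσ⟩, b, c⟩ := hg
  refine ⟨⟨σ, fun i => ⟨(hσ i).1, ?_⟩⟩, ?_, ?_⟩
  · apply Nat.dvd_antisymm
    · have h := (hσ i).2
      rw [MonoidHom.comp_apply] at h
      exact h ▸ orderOf_map_dvd f (g i)
    · exact orderOf_map_dvd φ (f (g i))
  · rw [Set.range_comp, ← MonoidHom.map_closure, b, Subgroup.map_top_of_surjective f hf]
  · rw [← List.map_ofFn, ← map_list_prod, c, map_one]

/-- The map `Ni(H', C)^in → Ni(H, C)^in` induced by a cover `f : H' → H` over `G`. -/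
def innerMap {φ : H →* G} {φ' : H' →* G} (C : Fin r → ConjClasses G) (f : H' →* H)
    (hf : Function.Surjective f) (hφ : φ.comp f = φ') : InnerNielsen φ' C → InnerNielsen φ C :=
  Quotient.map (sa := innerSetoid φ' C) (sb := innerSetoid φ C)
    (fun g => ⟨f ∘ g.1, g.2.map hf hφ⟩) (by
      rintro g g' ⟨h, hh⟩
      exact ⟨f h, fun i => by simp [hh]⟩)

end Nielsen

/-! ### Modular towers -/

section Towers

variable {A G : Type*} [Group A] [TopologicalSpace A] [IsTopologicalGroup A]
  [Group G] [TopologicalSpace G] [T1Space G] {r : ℕ}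

/-- The inner Nielsen class `Ni(A / ker_k, C)^in` of level `k` of the cover `ψ : A → G`. The level
`k` Hurwitz space is the covering of the space of `r`-element subsets of the Riemann sphere that
has this set as its fibre, with monodromy the braid action. -/
abbrev TowerLevel (ℓ : ℕ) (ψ : A →ₜ* G) (C : Fin r → ConjClasses G) (k : ℕ) : Type _ :=
  InnerNielsen (levelToBase ℓ ψ k) C

/-- The natural map from level `k + 1` to level `k`. -/
def towerMap (ℓ : ℕ) (ψ : A →ₜ* G) (C : Fin r → ConjClasses G) (k : ℕ) :
    TowerLevel ℓ ψ C (k + 1) → TowerLevel ℓ ψ C k :=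
  innerMap C (levelMap ℓ ψ k) (levelMap_surjective ℓ ψ k) (levelToBase_comp_levelMap ℓ ψ k)

/-- A modular tower on the cover `ψ : A → G`: a braid orbit `O k` on each level, such that the
natural map from level `k + 1` to level `k` maps `O (k + 1)` onto `O k`. -/
structure IsModularTower (ℓ : ℕ) (ψ : A →ₜ* G) (C : Fin r → ConjClasses G)
    (O : ∀ k, Set (TowerLevel ℓ ψ C k)) : Prop where
  orbit : ∀ k, IsBraidOrbit (levelToBase ℓ ψ k) C (O k)
  compat : ∀ k, towerMap ℓ ψ C k '' O (k + 1) = O k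

end Towers

end ModularTower

/-!
A level `A / ker_k` with a nonempty Nielsen class is finitely generated, by the entries of any of
its Nielsen tuples. Level `k + 1` is an extension of level `k` by the abelian group
`ker_k / ker_{k+1}` of exponent dividing `ℓ`, so Schreier's lemma shows by induction that all levels
are finite. The inner Nielsen classes then form an inverse sequence of nonempty finite sets, which
has a compatible sequence of points by Kőnig's lemma. The maps between levels commute with the
generators of the Hurwitz monodromy group, hence carry orbits onto orbits, and the braid orbits of
the chosen points form a modular tower.
-/

namespace ModularTower

open CategoryTheory in
theorem exists_compatible_sequence {X : ℕ → Type*} [∀ k, Finite (X k)] [∀ k, Nonempty (X k)]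
    (f : ∀ k, X (k + 1) → X k) : ∃ x : ∀ k, X k, ∀ k, f k (x (k + 1)) = x k := by
  let F : ℕᵒᵖ ⥤ Type _ := Functor.ofOpSequence (X := X) fun k => ↾(f k)
  have (j : ℕᵒᵖ) : Finite (F.obj j) := inferInstanceAs (Finite (X j.unop))
  have (j : ℕᵒᵖ) : Nonempty (F.obj j) := inferInstanceAs (Nonempty (X j.unop))
  obtain ⟨x, hx⟩ := nonempty_sections_of_finite_inverse_system F
  refine ⟨fun k => x (Opposite.op k), fun k => ?_⟩
  have hxk := hx (homOfLE k.le_succ).op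
  rwa [Functor.ofOpSequence_map_homOfLE_succ] at hxk

section FiniteIndex

variable {E : Type*} [Group E]

open scoped IsMulCommutative in
theorem finite_of_finiteIndex_of_isMulTorsion [Group.FG E] (K : Subgroup E) [K.FiniteIndex]
    [IsMulCommutative K] (hK : IsMulTorsion K) : Finite E := by
  have : Finite K := CommGroup.finite_of_fg_isMulTorsion K hK
  exact Finite.of_subgroup_quotient K

theorem finiteIndex_of_commutator_le_of_pow_mem {K L : Subgroup E} [K.FiniteIndex] [L.Normal]
    [Group.FG (E ⧸ L)] (hcomm : ⁅K, K⁆ ≤ L) (hpow : ∀ x ∈ K, ∃ n, 0 < n ∧ x ^ n ∈ L) :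
    L.FiniteIndex := by
  let π : E →* E ⧸ L := QuotientGroup.mk' L
  have : (K.map π).FiniteIndex :=
    ⟨ne_zero_of_dvd_ne_zero Subgroup.FiniteIndex.index_ne_zero
      (K.index_map_dvd (QuotientGroup.mk'_surjective L))⟩
  have : IsMulCommutative (K.map π) := by
    rwa [← Subgroup.le_centralizer_iff_isMulCommutative,
      ← Subgroup.commutator_eq_bot_iff_le_centralizer, ← Subgroup.map_commutator,
      Subgroup.map_eq_bot_iff, QuotientGroup.ker_mk']
  have htorsion : IsMulTorsion (K.map π) := by
    rintro ⟨_, x, hx, rfl⟩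
    obtain ⟨n, hn, hxn⟩ := hpow x hx
    exact isOfFinOrder_iff_pow_eq_one.2
      ⟨n, hn, Subtype.ext ((QuotientGroup.eq_one_iff (x ^ n)).2 hxn)⟩
  have : Finite (E ⧸ L) := finite_of_finiteIndex_of_isMulTorsion (K.map π) htorsion
  exact Subgroup.finiteIndex_of_finite_quotient

end FiniteIndex

section Intertwining

variable {M N X Y : Type*} [Group M] [Group N] [MulAction M X] [MulAction N Y]

variable (M N) in
/-- The pairs `(m, n)` of group elements whose actions on `X` and `Y` are intertwined by `f`, as a
subgroup of `M × N`. It compares two actions of different groups when no homomorphism between the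
groups is available, only a correspondence between generators. -/
def intertwiningPairs (f : X → Y) : Subgroup (M × N) where
  carrier := {p | ∀ x, f (p.1 • x) = p.2 • f x}
  one_mem' x := by simp only [Prod.fst_one, Prod.snd_one, one_smul]
  mul_mem' {p q} hp hq x := by
    simp only [Prod.fst_mul, Prod.snd_mul, mul_smul, hp (q.1 • x), hq x]
  inv_mem' {p} hp x := by
    simp only [Prod.fst_inv, Prod.snd_inv, eq_inv_smul_iff, ← hp (p.1⁻¹ • x), smul_inv_smul]

theorem image_orbit_of_le_intertwiningPairs {f : X → Y} {P : Subgroup (M × N)}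
    (hP : P ≤ intertwiningPairs M N f) (x : X) :
    f '' MulAction.orbit (P.map (MonoidHom.fst M N)) x =
      MulAction.orbit (P.map (MonoidHom.snd M N)) (f x) := by
  ext y
  constructor
  · rintro ⟨_, ⟨⟨_, p, hp, rfl⟩, rfl⟩, rfl⟩
    exact ⟨⟨p.2, p, hp, rfl⟩, (hP hp x).symm⟩
  · rintro ⟨⟨_, p, hp, rfl⟩, rfl⟩
    exact ⟨p.1 • x, ⟨⟨p.1, p, hp, rfl⟩, rfl⟩, hP hp x⟩

theorem image_orbit_closure_range {ι : Type*} {f : X → Y} {s : ι → M} {t : ι → N}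
    (h : ∀ i x, f (s i • x) = t i • f x) (x : X) :
    f '' MulAction.orbit (Subgroup.closure (Set.range s)) x =
      MulAction.orbit (Subgroup.closure (Set.range t)) (f x) := by
  have hP : Subgroup.closure (Set.range fun i => (s i, t i)) ≤ intertwiningPairs M N f := by
    rw [Subgroup.closure_le]
    rintro _ ⟨i, rfl⟩
    exact h i
  have himage := image_orbit_of_le_intertwiningPairs hP x
  rwa [MonoidHom.map_closure, MonoidHom.map_closure, ← Set.range_comp, ← Set.range_comp] at himage

end Intertwining

section BraidOrbits

variable {H H' G : Type*} [Group H] [Group H'] [Group G] {r : ℕ}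

/-- The generators `q_1, …, q_{r-1}` and `sh` of the Hurwitz monodromy group, acting on the inner
Nielsen class. They are indexed independently of the cover, so that the generators on different
covers can be matched; `none` stands for `sh` and `some i` for `q_{i+1}`. -/
def hurwitzGen (φ : H →* G) (C : Fin r → ConjClasses G) :
    Option {i : ℕ // i + 1 < r} → Equiv.Perm (InnerNielsen φ C)
  | none => shiftGen φ C
  | some i => braidGen φ C i.1 i.2

theorem hurwitzGroup_eq_closure_range_hurwitzGen (φ : H →* G) (C : Fin r → ConjClasses G) :
    hurwitzGroup φ C = Subgroup.closure (Set.range (hurwitzGen φ C)) := by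
  refine congrArg Subgroup.closure (Set.ext fun q => ⟨?_, ?_⟩)
  · rintro (⟨i, hi, rfl⟩ | rfl)
    · exact ⟨some ⟨i, hi⟩, rfl⟩
    · exact ⟨none, rfl⟩
  · rintro ⟨_ | i, rfl⟩
    · exact Or.inr rfl
    · exact Or.inl ⟨i.1, i.2, rfl⟩

theorem comp_braidFun (f : H' →* H) (i j : Fin r) (g : Fin r → H') :
    f ∘ braidFun i j g = braidFun i j (f ∘ g) := by
  funext k
  simp only [Function.comp_apply, braidFun, apply_ite f, map_mul, map_inv]

theorem innerMap_hurwitzGen {φ : H →* G} {φ' : H' →* G} (C : Fin r → ConjClasses G) (f : H' →* H)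
    (hf : Function.Surjective f) (hφ : φ.comp f = φ') (i : Option {i : ℕ // i + 1 < r})
    (x : InnerNielsen φ' C) :
    innerMap C f hf hφ (hurwitzGen φ' C i x) = hurwitzGen φ C i (innerMap C f hf hφ x) := by
  induction x using Quotient.inductionOn with
  | h g =>
    cases i with
    | none => rfl
    | some i => exact congrArg (Quotient.mk _) (Subtype.ext (comp_braidFun f _ _ g.1))

theorem image_innerMap_orbit {φ : H →* G} {φ' : H' →* G} (C : Fin r → ConjClasses G)
    (f : H' →* H) (hf : Function.Surjective f) (hφ : φ.comp f = φ') (x : InnerNielsen φ' C) :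
    innerMap C f hf hφ '' MulAction.orbit (hurwitzGroup φ' C) x =
      MulAction.orbit (hurwitzGroup φ C) (innerMap C f hf hφ x) := by
  rw [hurwitzGroup_eq_closure_range_hurwitzGen, hurwitzGroup_eq_closure_range_hurwitzGen]
  exact image_orbit_closure_range (innerMap_hurwitzGen C f hf hφ) x

theorem group_fg_of_nonempty_innerNielsen {φ : H →* G} {C : Fin r → ConjClasses G}
    (h : Nonempty (InnerNielsen φ C)) : Group.FG H := by
  obtain ⟨g⟩ := nonempty_quotient_iff (innerSetoid φ C) |>.1 h
  exact Group.fg_iff.2 ⟨_, g.2.generates, Set.finite_range g.1⟩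

instance finite_innerNielsen [Finite H] (φ : H →* G) (C : Fin r → ConjClasses G) :
    Finite (InnerNielsen φ C) :=
  inferInstanceAs (Finite (Quotient (innerSetoid φ C)))

end BraidOrbits

section FiniteLevels

variable {A G : Type*} [Group A] [TopologicalSpace A] [IsTopologicalGroup A]

theorem pow_mem_lFrattini (ℓ : ℕ) {K : Subgroup A} {x : A} (hx : x ∈ K) : x ^ ℓ ∈ lFrattini ℓ K :=
  Subgroup.le_topologicalClosure _ (Subgroup.mem_sup_left (Subgroup.subset_closure ⟨x, hx, rfl⟩))

theorem commutator_le_lFrattini (ℓ : ℕ) (K : Subgroup A) : ⁅K, K⁆ ≤ lFrattini ℓ K :=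
  le_sup_right.trans (Subgroup.le_topologicalClosure _)

theorem finiteIndex_lFrattini {ℓ : ℕ} (hℓ : ℓ ≠ 0) (K : Subgroup A) [K.Normal] [K.FiniteIndex]
    [Group.FG (A ⧸ lFrattini ℓ K)] : (lFrattini ℓ K).FiniteIndex :=
  finiteIndex_of_commutator_le_of_pow_mem (commutator_le_lFrattini ℓ K) fun _ hx =>
    ⟨ℓ, hℓ.pos, pow_mem_lFrattini ℓ hx⟩

theorem finiteIndex_charKer [Group G] [TopologicalSpace G] [Finite G] {ℓ : ℕ} (hℓ : ℓ ≠ 0)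
    (ψ : A →ₜ* G) (hfg : ∀ k, Group.FG (Level ℓ ψ k)) : ∀ k, (charKer ℓ ψ k).FiniteIndex
  | 0 => inferInstanceAs ψ.toMonoidHom.ker.FiniteIndex
  | k + 1 =>
    have := finiteIndex_charKer hℓ ψ hfg k
    have : Group.FG (A ⧸ lFrattini ℓ (charKer ℓ ψ k)) := hfg (k + 1)
    finiteIndex_lFrattini hℓ (charKer ℓ ψ k)

end FiniteLevels

end ModularTower

open ModularTower in
theorem mainTheorem7_general {A G : Type*} [Group A] [TopologicalSpace A] [IsTopologicalGroup A]
    [Group G] [Finite G] [TopologicalSpace G] [T1Space G] {ℓ r : ℕ} (hℓ : ℓ ≠ 0) (ψ : A →ₜ* G)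
    (C : Fin r → ConjClasses G) (hne : ∀ k, Nonempty (TowerLevel ℓ ψ C k)) :
    ∃ O : ∀ k, Set (TowerLevel ℓ ψ C k), IsModularTower ℓ ψ C O := by
  have hfg (k : ℕ) : Group.FG (Level ℓ ψ k) := group_fg_of_nonempty_innerNielsen (hne k)
  have := finiteIndex_charKer hℓ ψ hfg
  obtain ⟨x, hx⟩ := exists_compatible_sequence (towerMap ℓ ψ C)
  refine ⟨fun k => MulAction.orbit (hurwitzGroup (levelToBase ℓ ψ k) C) (x k),
    fun k => ⟨x k, rfl⟩, fun k => ?_⟩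
  rw [← hx k]
  exact image_innerMap_orbit C _ _ _ (x (k + 1))

theorem mainTheorem7 {G : Type*} [Group G] [Finite G] [TopologicalSpace G] [DiscreteTopology G]
    (ℓ : ℕ) (hℓ : ℓ.Prime) (hdvd : ℓ ∣ Nat.card G) (hperf : ModularTower.IsLPerfect ℓ G)
    {r : ℕ} (C : Fin r → ConjClasses G)
    (hC : ∀ i, ∀ x ∈ (C i).carrier, (orderOf x).Coprime ℓ)
    {Gt : Type*} [Group Gt] [TopologicalSpace Gt] [IsTopologicalGroup Gt] [CompactSpace Gt]
    [T2Space Gt] [TotallyDisconnectedSpace Gt] (ψ : Gt →ₜ* G)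
    (hψ : ModularTower.IsUniversalLFrattiniCover ℓ ψ)
    (hne : ∀ k, Nonempty (ModularTower.TowerLevel ℓ (ModularTower.abCoverMap ψ) C k)) :
    ∃ O : ∀ k, Set (ModularTower.TowerLevel ℓ (ModularTower.abCoverMap ψ) C k),
      ModularTower.IsModularTower ℓ (ModularTower.abCoverMap ψ) C O :=
  mainTheorem7_general hℓ.ne_zero _ C hne
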